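/- Fix a field $K$ and a compact interval $[T_0,T_1]\subset\mathbb{R}$. A persistence module $X$ is a family of $K$-vector spaces $(X_a)_{a\in\mathbb{R}}$ with functorial transition maps $X_a\to X_b$ for $a\le b$. An $\varepsilon$-morphism $X\to Y$ is a family of linear maps $X_a\to Y_{a+\varepsilon}$ commuting with the transition maps. For $b<d\le\infty$ with $b$ finite, $I[b,d)$ is the module equal to $K$ at heights in $[b,d)$ and to $0$ elsewhere, with identity transition maps inside $[b,d)$. If $X\cong\bigoplus_{i=1}^n I[b_i,d_i)$, the persistence diagram of $X$ is the finite multiset $\{(b_i,d_i)\}$. A ($1$-Lipschitz) vineyard module $\mathbb{V}$ over $[T_0,T_1]$ is a family of persistence modules $(V_t)_{t\in[T_0,T_1]}$ together with, for all $s<t$, an $|s-t|$-interleaving $\alpha_s^t:V_s\to V_t$, $\beta_t^s:V_t\to V_s$, such that all these maps commute with each other and with the transition maps. Isomorphisms and finite direct sums of vineyard modules are taken at each time $t$, compatibly with the interleaving maps; $\mathbb{V}$ is zero if all its vector spaces are zero, and indecomposable if it is non-zero and not isomorphic to a direct sum of two non-zero vineyard modules. A vine over $[T_0,T_1]$ is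 a map $\gamma$ from $[T_0,T_1]$ to persistence diagrams that is continuous for the bottleneck distance, such that each $\gamma(t)$ has at most one (off-diagonal) point and the support $\{t:\gamma(t)\ne\emptyset\}$ is a non-empty interval. The vineyard of $\mathbb{V}$ is the union of vines $\gamma_j$, $j\in S$, if for every $t$ the module $V_t$ is isomorphic to a finite direct sum of interval modules and its persistence diagram is $\bigcup_{j\in S}\gamma_j(t)$, counted with multiplicity. **Corollary.** Let $\mathbb{V}$ be a vineyard module over $[T_0,T_1]$ whose vineyard is the union of vines $\gamma_1,\dots,\gamma_N$, and suppose that no persistence diagram of a $V_t$ contains a point of multiplicity greater than $1$. Let $\mathbb{V}\cong\bigoplus_{i=1}^k\mathbb{V}_i$ be a decomposition into (non-zero) indecomposable vineyard modules. Then $k\le N$, and there is a partition $\{1,\dots,N\}=\bigsqcup_{i=1}^k P_i$ into non-empty blocks such that, for every $i$, the vineyard of $\mathbb{V}_i$ is the union of the vines $\gamma_j$ with $j\in P_i$. -/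

import Mathlib

open scoped ENNReal

universe u v w

noncomputable section

/-! ### Persistence modules -/

/-- A persistence module over `K`: vector spaces indexed by the heights `a : ℝ`, with functorial
transition maps. -/
structure PersistenceModule (K : Type u) [Field K] where
  obj : ℝ → ModuleCat.{v} K
  map : ∀ {a b : ℝ}, a ≤ b → (obj a →ₗ[K] obj b)
  map_refl : ∀ (a : ℝ) (x : obj a), map (le_refl a) x = x
  map_comp : ∀ {a b c : ℝ} (hab : a ≤ b) (hbc : b ≤ c) (x : obj a),
    map hbc (map hab x) = map (hab.trans hbc) x

namespace PersistenceModule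

variable {K : Type u} [Field K]

/-- An `ε`-morphism: linear maps `X_a → Y_{a+ε}` commuting with the transition maps. -/
structure EpsMorphism (ε : ℝ) (X : PersistenceModule.{u, v} K) (Y : PersistenceModule.{u, w} K) where
  app : ∀ a : ℝ, X.obj a →ₗ[K] Y.obj (a + ε)
  naturality : ∀ {a b : ℝ} (h : a ≤ b) (x : X.obj a),
    app b (X.map h x) = Y.map (by linarith) (app a x)

/-- An isomorphism of persistence modules: linear isomorphisms `X_a ≃ Y_a` commuting with the
transition maps. -/
structure Iso (X : PersistenceModule.{u, v} K) (Y : PersistenceModule.{u, w} K) where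
  app : ∀ a : ℝ, X.obj a ≃ₗ[K] Y.obj a
  naturality : ∀ {a b : ℝ} (h : a ≤ b) (x : X.obj a), app b (X.map h x) = Y.map h (app a x)

/-- The direct sum of a finite family of persistence modules. -/
def directSum {ι : Type} [Fintype ι] (X : ι → PersistenceModule.{u, v} K) :
    PersistenceModule.{u, v} K where
  obj a := ModuleCat.of K (∀ i, (X i).obj a)
  map h := LinearMap.pi fun i => (X i).map h ∘ₗ LinearMap.proj i
  map_refl a x := by
    funext i
    exact (X i).map_refl a (x i)
  map_comp hab hbc x := by
    funext i
    exact (X i).map_comp hab hbc (x i)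

end PersistenceModule

/-! ### Persistence diagrams and the bottleneck distance -/

/-- An off-diagonal point `(birth, death)` with finite birth and with `birth < death ≤ ∞`; it
stands for the half-open interval `[birth, death)`. -/
structure Bar where
  birth : ℝ
  death : WithTop ℝ
  lt : (birth : WithTop ℝ) < death

namespace Bar

/-- The height `a` lies in `[birth, death)`. -/
def Alive (p : Bar) (a : ℝ) : Prop := p.birth ≤ a ∧ (a : WithTop ℝ) < p.death

/-- The subspace of `K` which is `K` itself for `a ∈ [birth, death)` and `0` otherwise. -/
def space (K : Type u) [Field K] (p : Bar) (a : ℝ) : Submodule K K where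
  carrier := {x | ¬ p.Alive a → x = 0}
  add_mem' := fun hx hy h => by rw [hx h, hy h, add_zero]
  zero_mem' := fun _ => rfl
  smul_mem' := fun c x hx h => by rw [hx h, smul_zero]

open Classical in
/-- The interval module of `[birth, death)`: the transition maps are the identity between heights
in the interval and `0` otherwise. -/
def intervalModule (K : Type u) [Field K] (p : Bar) : PersistenceModule.{u, u} K where
  obj a := ModuleCat.of K (p.space K a)
  map {a b} _ :=
    { toFun := fun x => (⟨if p.Alive b then x.1 else 0, fun h => if_neg h⟩ : p.space K b)
      map_add' := fun x y => by
        apply Subtype.ext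
        by_cases h : p.Alive b <;> simp [h]
      map_smul' := fun c x => by
        apply Subtype.ext
        by_cases h : p.Alive b <;> simp [h] }
  map_refl a x := by
    apply Subtype.ext
    by_cases h : p.Alive a
    · exact if_pos h
    · exact (if_neg h).trans (x.2 h).symm
  map_comp {a b c} hab hbc x := by
    apply Subtype.ext
    change (if p.Alive c then (if p.Alive b then x.1 else 0) else 0) = if p.Alive c then x.1 else 0
    by_cases hc : p.Alive c
    · by_cases hb : p.Alive b
      · simp [hb]
      · have ha : ¬ p.Alive a := fun ha =>
          hb ⟨ha.1.trans hab, lt_of_le_of_lt (WithTop.coe_le_coe.2 hbc) hc.2⟩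
        simp [hb, x.2 ha]
    · simp [hc]

/-- The distance of two death values, with `|∞ - ∞| = 0` and `|∞ - d| = ∞` for finite `d`. -/
def deathDist : WithTop ℝ → WithTop ℝ → ℝ≥0∞
  | (c : ℝ), (d : ℝ) => ENNReal.ofReal |c - d|
  | ⊤, ⊤ => 0
  | _, _ => ⊤

/-- The cost of matching two points: their distance in the maximum norm. -/
def matchCost (p q : Bar) : ℝ≥0∞ :=
  max (ENNReal.ofReal |p.birth - q.birth|) (deathDist p.death q.death)

/-- The cost of leaving a point unmatched: half of its persistence `death - birth`. -/
def unmatchedCost (p : Bar) : ℝ≥0∞ := deathDist p.birth p.death / 2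

end Bar

/-- A persistence diagram: a finite multiset of off-diagonal points. -/
abbrev Diagram := Multiset Bar

namespace Diagram

/-- A transportation plan between two diagrams: a partial matching, given by the multiset of
matched pairs and the multisets of points left unmatched. -/
structure Plan (X Y : Diagram) where
  matched : Multiset (Bar × Bar)
  leftX : Multiset Bar
  leftY : Multiset Bar
  fst_eq : matched.map Prod.fst + leftX = X
  snd_eq : matched.map Prod.snd + leftY = Y

/-- The cost of a transportation plan. -/
def Plan.cost {X Y : Diagram} (M : Plan X Y) : ℝ≥0∞ :=
  max (⨆ m ∈ M.matched, m.1.matchCost m.2)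
    (max (⨆ p ∈ M.leftX, p.unmatchedCost) (⨆ q ∈ M.leftY, q.unmatchedCost))

/-- The bottleneck distance. -/
def bottleneck (X Y : Diagram) : ℝ≥0∞ := ⨅ M : Plan X Y, M.cost

end Diagram

/-- `X` is isomorphic to the direct sum of the interval modules of the points of `D`, counted with
multiplicity; that is, `D` is the persistence diagram of `X`. -/
def PersistenceModule.HasDiagram {K : Type u} [Field K] (X : PersistenceModule.{u, v} K)
    (D : Diagram) : Prop :=
  ∃ (n : ℕ) (p : Fin n → Bar), Multiset.map p Finset.univ.val = D ∧
    Nonempty (X.Iso (PersistenceModule.directSum fun i => (p i).intervalModule K))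

/-! ### Vineyards and vines -/

/-- A vineyard over `[T₀, T₁]`: a path of persistence diagrams which is continuous for the
bottleneck distance. -/
structure Vineyard (T₀ T₁ : ℝ) where
  diagram : Set.Icc T₀ T₁ → Diagram
  continuous : ∀ t : Set.Icc T₀ T₁, ∀ ε : ℝ≥0∞, 0 < ε → ∃ δ : ℝ, 0 < δ ∧
    ∀ s : Set.Icc T₀ T₁, |(s : ℝ) - t| < δ → Diagram.bottleneck (diagram s) (diagram t) < ε

/-- The times at which the diagram has an off-diagonal point. -/
def Vineyard.support {T₀ T₁ : ℝ} (D : Vineyard T₀ T₁) : Set ℝ :=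
  {t | ∃ h : t ∈ Set.Icc T₀ T₁, D.diagram ⟨t, h⟩ ≠ 0}

/-- A vine: a vineyard with at most one off-diagonal point at each time, whose support is a
non-empty interval. -/
structure Vine (T₀ T₁ : ℝ) extends Vineyard T₀ T₁ where
  card_le_one : ∀ t : Set.Icc T₀ T₁, Multiset.card (diagram t) ≤ 1
  support_nonempty : toVineyard.support.Nonempty
  support_interval : toVineyard.support.OrdConnected

/-! ### Vineyard modules -/

/-- A (`1`-Lipschitz) vineyard module over `[T₀, T₁]`: persistence modules `V_t`, and for all times
`s, t` an `|s - t|`-morphism `inter s t : V_s → V_t`. For `s < t`, the maps `inter s t` and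
`inter t s` are the two interleaving maps `α_s^t` and `β_t^s`; for `s = t` there is no further datum,
since `inter t t` is the identity. All of them commute with each other and with the transition maps:
going from `V_r` to `V_s` and on to `V_t` is the map from `V_r` to `V_t` followed by a transition
map. The case `t = r` says that `inter r s` and `inter s r` form an `|r - s|`-interleaving. -/
structure VineyardModule (K : Type u) [Field K] (T₀ T₁ : ℝ) where
  fiber : Set.Icc T₀ T₁ → PersistenceModule.{u, v} K
  inter : ∀ s t : Set.Icc T₀ T₁,
    PersistenceModule.EpsMorphism |(s : ℝ) - t| (fiber s) (fiber t)
  inter_self : ∀ (t : Set.Icc T₀ T₁) (a : ℝ) (x : (fiber t).obj a),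
    (inter t t).app a x = (fiber t).map (by simp) x
  inter_comp : ∀ (r s t : Set.Icc T₀ T₁) (a : ℝ) (x : (fiber r).obj a),
    (inter s t).app (a + |(r : ℝ) - s|) ((inter r s).app a x) =
      (fiber t).map (by linarith [abs_sub_le (r : ℝ) s t]) ((inter r t).app a x)

namespace VineyardModule

variable {K : Type u} [Field K] {T₀ T₁ : ℝ}

/-- The two maps between `V_s` and `V_t` form an interleaving. -/
theorem inter_inter (V : VineyardModule.{u, v} K T₀ T₁) (s t : Set.Icc T₀ T₁) (a : ℝ)
    (x : (V.fiber s).obj a) :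
    (V.inter t s).app (a + |(s : ℝ) - t|) ((V.inter s t).app a x) =
      (V.fiber s).map (by linarith [abs_nonneg ((s : ℝ) - t), abs_nonneg ((t : ℝ) - s)]) x := by
  rw [V.inter_comp, V.inter_self, PersistenceModule.map_comp]

/-- An isomorphism of vineyard modules: isomorphisms `V_t ≅ W_t` commuting with the interleaving
maps. -/
structure Iso (V : VineyardModule.{u, v} K T₀ T₁) (W : VineyardModule.{u, w} K T₀ T₁) where
  app : ∀ t : Set.Icc T₀ T₁, (V.fiber t).Iso (W.fiber t)
  naturality : ∀ (s t : Set.Icc T₀ T₁) (a : ℝ) (x : (V.fiber s).obj a),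
    ((app t).app (a + |(s : ℝ) - t|)) ((V.inter s t).app a x) =
      (W.inter s t).app a ((app s).app a x)

/-- The direct sum of a finite family of vineyard modules. -/
def directSum {ι : Type} [Fintype ι] (W : ι → VineyardModule.{u, v} K T₀ T₁) :
    VineyardModule.{u, v} K T₀ T₁ where
  fiber t := PersistenceModule.directSum fun i => (W i).fiber t
  inter s t :=
    { app := fun a => LinearMap.pi fun i => ((W i).inter s t).app a ∘ₗ LinearMap.proj i
      naturality := fun h x => by
        funext i
        exact ((W i).inter s t).naturality h (x i) }
  inter_self t a x := by
    funext i
    exact (W i).inter_self t a (x i)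
  inter_comp r s t a x := by
    funext i
    exact (W i).inter_comp r s t a (x i)

/-- The zero vineyard module: all its vector spaces are zero. -/
def IsZero (V : VineyardModule.{u, v} K T₀ T₁) : Prop :=
  ∀ (t : Set.Icc T₀ T₁) (a : ℝ), Subsingleton ((V.fiber t).obj a)

/-- `V` is non-zero and is not isomorphic to a direct sum of two non-zero vineyard modules. -/
def Indecomposable (V : VineyardModule.{u, v} K T₀ T₁) : Prop :=
  ¬ V.IsZero ∧ ∀ A B : VineyardModule.{u, v} K T₀ T₁,
    Nonempty (V.Iso (directSum ![A, B])) → A.IsZero ∨ B.IsZero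

/-- The vineyard of `V` is the union of the vines `γ j` with `j ∈ S`: at every time `t`, the
persistence diagram of `V_t` is the union, with multiplicities, of the diagrams of these vines. -/
def HasVines (V : VineyardModule.{u, v} K T₀ T₁) {N : ℕ} (γ : Fin N → Vine T₀ T₁)
    (S : Finset (Fin N)) : Prop :=
  ∀ t : Set.Icc T₀ T₁, (V.fiber t).HasDiagram (∑ j ∈ S, (γ j).diagram t)

end VineyardModule

end

-- At each time the direct sum decomposition distributes the bars of `V_t` over the summands
-- (`exists_iso_fiber_of_directSum_iso`), and since bars are pairwise distinct each bar has exactly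
-- one owner. The point is that a vine never changes owner. If a bar `p` of `γ j` belongs to `W i`
-- at time `t`, the interleaving inside `W i` gives, at a nearby time, a bar of `W i` close to `p`
-- (`exists_matchCost_le_of_interleaving`). The other vines stay away from `p`, so this bar lies on
-- `γ j`. Hence the owner is locally constant on the support of `γ j`, which is an interval, and so
-- constant. The block of `W i` is the set of vines it owns, non-empty because `W i` is non-zero.
--
-- Both algebraic inputs rest on `le_of_natural_ne_zero`: up to the shift, a non-zero map of
-- interval modules cannot raise birth or death. The monotone reindexing `g` covers ordinary
-- morphisms and `ε`-morphisms at once.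

universe w'

/-! ### Natural families and isomorphisms -/

namespace PersistenceModule

variable {K : Type u} [Field K]

/-- Naturality of a family of linear maps `X_a → Y_{g a}` along a monotone reindexing `g`. -/
def IsNatural {X : PersistenceModule.{u, v} K} {Y : PersistenceModule.{u, w} K} {g : ℝ → ℝ}
    (hg : Monotone g) (f : ∀ a, X.obj a →ₗ[K] Y.obj (g a)) : Prop :=
  ∀ {a b : ℝ} (h : a ≤ b) (x : X.obj a), f b (X.map h x) = Y.map (hg h) (f a x)

namespace Iso

variable {X : PersistenceModule.{u, v} K} {Y : PersistenceModule.{u, w} K}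

theorem symm_naturality (e : X.Iso Y) {a b : ℝ} (h : a ≤ b) (y : Y.obj a) :
    (e.app b).symm (Y.map h y) = X.map h ((e.app a).symm y) := by
  rw [LinearEquiv.symm_apply_eq, e.naturality, LinearEquiv.apply_symm_apply]

/-- The inverse of an isomorphism. -/
def symm (e : X.Iso Y) : Y.Iso X where
  app a := (e.app a).symm
  naturality h y := e.symm_naturality h y

/-- The composition of two isomorphisms. -/
def trans {Z : PersistenceModule.{u, w'} K} (e : X.Iso Y) (f : Y.Iso Z) : X.Iso Z where
  app a := (e.app a).trans (f.app a)
  naturality h x := by simp [e.naturality, f.naturality]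

end Iso

end PersistenceModule

/-! ### Coordinates on finite direct sums -/

namespace PersistenceModule

variable {K : Type u} [Field K] {ι : Type} [Fintype ι] [DecidableEq ι]

/-- The inclusion of a summand. -/
def incl (X : ι → PersistenceModule.{u, v} K) (i : ι) (a : ℝ) :
    (X i).obj a →ₗ[K] (directSum X).obj a :=
  LinearMap.single K (fun i => (X i).obj a) i

/-- The projection to a summand. -/
def proj {ι : Type} [Fintype ι] (X : ι → PersistenceModule.{u, v} K) (i : ι) (a : ℝ) :
    (directSum X).obj a →ₗ[K] (X i).obj a :=
  LinearMap.proj (φ := fun i => (X i).obj a) i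

theorem proj_map {ι : Type} [Fintype ι] (X : ι → PersistenceModule.{u, v} K) (i : ι) {a b : ℝ} (h : a ≤ b)
    (x : (directSum X).obj a) : proj X i b ((directSum X).map h x) = (X i).map h (proj X i a x) :=
  rfl

theorem incl_map (X : ι → PersistenceModule.{u, v} K) (i : ι) {a b : ℝ} (h : a ≤ b)
    (x : (X i).obj a) : incl X i b ((X i).map h x) = (directSum X).map h (incl X i a x) := by
  funext j
  change Pi.single (M := fun i => (X i).obj b) i _ j =
    (X j).map h (Pi.single (M := fun i => (X i).obj a) i x j)
  rcases eq_or_ne j i with rfl | hj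
  · simp
  · simp [Pi.single_eq_of_ne hj]

theorem sum_incl_proj (X : ι → PersistenceModule.{u, v} K) (a : ℝ) (x : (directSum X).obj a) :
    ∑ i, incl X i a (proj X i a x) = x :=
  Finset.univ_sum_single (M := fun i => (X i).obj a) x

theorem proj_incl_same (X : ι → PersistenceModule.{u, v} K) (i : ι) (a : ℝ) (x : (X i).obj a) :
    proj X i a (incl X i a x) = x :=
  Pi.single_eq_same (M := fun i => (X i).obj a) i x

theorem directSum_ext {ι : Type} [Fintype ι] {X : ι → PersistenceModule.{u, v} K} {a : ℝ}
    {x y : (directSum X).obj a} (h : ∀ i, proj X i a x = proj X i a y) : x = y :=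
  funext h

end PersistenceModule

/-! ### Maps out of interval modules -/

namespace Bar

variable (K : Type u) [Field K] {p q : Bar}

/-- The generator of the interval module, at the height of birth. -/
def gen (p : Bar) : (p.intervalModule K).obj p.birth :=
  (⟨1, fun h => absurd ⟨le_rfl, p.lt⟩ h⟩ : p.space K p.birth)

variable {K}

theorem eq_zero_of_not_alive {a : ℝ} (h : ¬ p.Alive a) (x : (p.intervalModule K).obj a) : x = 0 :=
  Subtype.ext (Subtype.property (p := (· ∈ p.space K a)) x h)

open Classical in
theorem map_ne_zero {a b : ℝ} (h : a ≤ b) (hb : p.Alive b) {x : (p.intervalModule K).obj a}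
    (hx : x ≠ 0) : (p.intervalModule K).map h x ≠ 0 := by
  intro h0
  apply hx
  have h1 : (if p.Alive b then Subtype.val (p := (· ∈ p.space K a)) x else 0) = 0 :=
    congrArg (Subtype.val (p := (· ∈ p.space K b))) h0
  rw [if_pos hb] at h1
  exact Subtype.ext h1

theorem gen_ne_zero : p.gen K ≠ 0 := fun h =>
  one_ne_zero (α := K) (congrArg (Subtype.val (p := (· ∈ p.space K p.birth))) h)

open Classical in
-- Interval modules are cyclic, so natural families out of them can be tested at the height of
-- birth.
theorem exists_smul_gen {a : ℝ} (ha : p.birth ≤ a) (x : (p.intervalModule K).obj a) :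
    ∃ c : K, x = c • (p.intervalModule K).map ha (p.gen K) := by
  by_cases h : p.Alive a
  · refine ⟨Subtype.val (p := (· ∈ p.space K a)) x, Subtype.ext ?_⟩
    change _ = _ * (if p.Alive a then (1 : K) else 0)
    rw [if_pos h, mul_one]
  · exact ⟨0, (eq_zero_of_not_alive h _).trans (zero_smul K _).symm⟩

/-- A natural family of maps between interval modules is determined at the generator. -/
theorem natural_gen_ne_zero {g : ℝ → ℝ} {hg : Monotone g}
    {Y : PersistenceModule.{u, w} K} {f : ∀ a, (p.intervalModule K).obj a →ₗ[K] Y.obj (g a)}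
    (hf : PersistenceModule.IsNatural hg f) {a : ℝ} {x : (p.intervalModule K).obj a}
    (hx : f a x ≠ 0) : f p.birth (p.gen K) ≠ 0 := by
  intro h0
  have ha : p.Alive a := by
    by_contra h
    exact hx (by rw [eq_zero_of_not_alive h x, map_zero])
  obtain ⟨c, rfl⟩ := exists_smul_gen ha.1 x
  apply hx
  rw [map_smul, hf, h0, map_zero, smul_zero]

/-- A nonzero natural family of maps between interval modules moves births and deaths down. -/
theorem le_of_natural_ne_zero {g : ℝ → ℝ} {hg : Monotone g}
    {f : ∀ a, (p.intervalModule K).obj a →ₗ[K] (q.intervalModule K).obj (g a)}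
    (hf : PersistenceModule.IsNatural hg f) {a : ℝ} {x : (p.intervalModule K).obj a}
    (hx : f a x ≠ 0) :
    q.birth ≤ g p.birth ∧ ∀ d : ℝ, p.death = d → q.death ≤ (g d : ℝ) := by
  have hgen := natural_gen_ne_zero hf hx
  have hb : q.Alive (g p.birth) := by
    by_contra h
    exact hgen (eq_zero_of_not_alive h _)
  refine ⟨hb.1, fun d hd => ?_⟩
  -- At height `d` the generator of `p` is dead, so its image vanishes at `g d`; if `q` were still
  -- alive there, that non-zero image would survive.
  by_contra! h
  have hpd : p.birth ≤ d := by
    have := p.lt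
    rw [hd] at this
    exact (WithTop.coe_lt_coe.1 this).le
  refine map_ne_zero (hg hpd) ⟨hb.1.trans (hg hpd), h⟩ hgen ?_
  rw [← hf hpd, eq_zero_of_not_alive (fun h => ?_) ((p.intervalModule K).map hpd _), map_zero]
  exact absurd h.2 (by rw [hd]; exact lt_irrefl _)

end Bar

/-! ### Distribution of distinct bars over direct summands -/

namespace PersistenceModule

variable {K : Type u} [Field K]

open Classical in
/-- A decomposition of a finite direct sum of pairwise distinct interval modules as a direct sum
distributes the intervals over the summands. -/
theorem exists_iso_fiber_of_directSum_iso {ι κ : Type} [Fintype ι] [Fintype κ] {p : ι → Bar}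
    (hp : Function.Injective p) (W : κ → PersistenceModule.{u, v} K)
    (F : (directSum W).Iso (directSum fun y => (p y).intervalModule K)) :
    ∃ c : ι → κ, ∀ i, Nonempty
      ((W i).Iso (directSum fun y : {y // c y = i} => (p y).intervalModule K)) := by
  set I : ι → PersistenceModule.{u, u} K := fun y => (p y).intervalModule K
  -- the components of the two isomorphisms
  let g : ∀ i y a, (I y).obj a →ₗ[K] (W i).obj a := fun i y a =>
    proj W i a ∘ₗ (F.app a).symm.toLinearMap ∘ₗ incl I y a
  let r : ∀ q i a, (W i).obj a →ₗ[K] (I q).obj a := fun q i a =>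
    proj I q a ∘ₗ (F.app a).toLinearMap ∘ₗ incl W i a
  have hg : ∀ i y {a b : ℝ} (h : a ≤ b) (x : (I y).obj a),
      g i y b ((I y).map h x) = (W i).map h (g i y a x) := fun i y a b h x => by
    simp only [g, LinearMap.comp_apply, LinearEquiv.coe_coe]
    rw [incl_map, F.symm_naturality, proj_map]
  have hr : ∀ q i {a b : ℝ} (h : a ≤ b) (x : (W i).obj a),
      r q i b ((W i).map h x) = (I q).map h (r q i a x) := fun q i a b h x => by
    simp only [r, LinearMap.comp_apply, LinearEquiv.coe_coe]
    rw [incl_map, F.naturality, proj_map]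
  let f : ∀ i q y a, (I y).obj a →ₗ[K] (I q).obj (id a) := fun i q y a => r q i a ∘ₗ g i y a
  have hf : ∀ i q y, IsNatural monotone_id (f i q y) := fun i q y a b h x => by
    simp only [f, LinearMap.comp_apply]
    rw [hg, hr]
  -- a nonzero diagonal entry
  have hc : ∀ y, ∃ i, f i y y (p y).birth ((p y).gen K) ≠ 0 := by
    intro y
    by_contra! h
    -- The diagonal entries through the various `W i` add up to the identity of `I y`, so they
    -- cannot all kill the generator.
    apply Bar.gen_ne_zero (K := K) (p := p y)
    have h1 := sum_incl_proj W _ ((F.app _).symm (incl I y _ ((p y).gen K)))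
    have h2 := congrArg (fun x => proj I y _ (F.app _ x)) h1
    simp only [map_sum, LinearEquiv.apply_symm_apply] at h2
    rw [proj_incl_same] at h2
    rw [← h2]
    exact Finset.sum_eq_zero fun i _ => h i
  choose c hc using hc
  have hdiag : ∀ y a (x : (I y).obj a), x ≠ 0 → f (c y) y y a x ≠ 0 := by
    intro y a x hx
    have ha : (p y).Alive a := by
      by_contra h
      exact hx (Bar.eq_zero_of_not_alive h x)
    obtain ⟨s, rfl⟩ := Bar.exists_smul_gen ha.1 x
    have hs : s ≠ 0 := by
      rintro rfl
      exact hx (zero_smul _ _)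
    rw [map_smul]
    refine smul_ne_zero hs ?_
    rw [hf]
    exact Bar.map_ne_zero _ ha (hc y)
  -- the comparison map
  let Φ : ∀ a, (directSum I).obj a →ₗ[K] (directSum W).obj a := fun a =>
    LinearMap.pi fun i => ∑ y with c y = i, g i y a ∘ₗ proj I y a
  have hΦ : ∀ a x i, proj W i a (Φ a x) = ∑ y with c y = i, g i y a (proj I y a x) := by
    intro a x i
    change (∑ y with c y = i, g i y a ∘ₗ proj I y a) x = _
    rw [LinearMap.sum_apply]
    rfl
  have hFΦ : ∀ a x q, proj I q a (F.app a (Φ a x)) = ∑ y, f (c y) q y a (proj I y a x) := by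
    intro a x q
    rw [← sum_incl_proj W a (Φ a x)]
    simp only [map_sum]
    rw [← Finset.sum_fiberwise (s := Finset.univ) (g := c)]
    refine Finset.sum_congr rfl fun i _ => ?_
    rw [hΦ, map_sum, map_sum, map_sum]
    refine Finset.sum_congr rfl fun y hy => ?_
    obtain rfl := (Finset.mem_filter.1 hy).2
    rfl
  -- This composite is triangular: its entry from `y` to `q` vanishes unless birth and death of `q`
  -- are at most those of `y`. At a maximal bar `q` of the support of `x` only the injective
  -- diagonal entry contributes, as equal endpoints force `y = q`.
  have hinj : ∀ a, Function.Injective ((F.app a).toLinearMap ∘ₗ Φ a) := by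
    intro a
    rw [← LinearMap.ker_eq_bot, LinearMap.ker_eq_bot']
    intro x hx
    by_contra hne
    have hsupp : (Finset.univ.filter fun y => proj I y a x ≠ 0).Nonempty := by
      rw [Finset.nonempty_iff_ne_empty]
      intro h
      apply hne
      refine directSum_ext fun y => ?_
      by_contra hy
      have : y ∈ Finset.univ.filter fun y => proj I y a x ≠ 0 := by simpa using hy
      rw [h] at this
      simp at this
    obtain ⟨q, hq, hmax⟩ := Finset.exists_maximalFor (fun y => ((p y).birth, (p y).death)) _ hsupp
    have h0 : proj I q a (F.app a (Φ a x)) = 0 := by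
      rw [show F.app a (Φ a x) = 0 from hx, map_zero]
    rw [hFΦ, Finset.sum_eq_single q] at h0
    · exact hdiag q a _ (Finset.mem_filter.1 hq).2 h0
    · intro y _ hyq
      by_contra hy
      apply hyq
      apply hp
      have hle := Bar.le_of_natural_ne_zero (hf (c y) q y) hy
      have hle' : ((p q).birth, (p q).death) ≤ ((p y).birth, (p y).death) := by
        refine ⟨hle.1, ?_⟩
        change (p q).death ≤ (p y).death
        cases hd : (p y).death with
        | top => exact le_top
        | coe d => exact hle.2 d hd
      have hys : y ∈ Finset.univ.filter fun y => proj I y a x ≠ 0 := by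
        rw [Finset.mem_filter]
        refine ⟨Finset.mem_univ _, fun h => hy ?_⟩
        rw [h, map_zero]
      have heq := le_antisymm (hmax hys hle') hle'
      rw [Prod.mk.injEq] at heq
      cases hpy : p y
      cases hpq : p q
      simp only [hpy, hpq] at heq
      simp [heq]
    · simp
  have hbij : ∀ a, Function.Bijective (Φ a) := by
    intro a
    have h1 : Function.Injective (Φ a) := fun x y h => hinj a (congrArg (F.app a) h)
    refine ⟨h1, fun w => ?_⟩
    have : FiniteDimensional K ((directSum I).obj a) :=
      inferInstanceAs (FiniteDimensional K (∀ y, (p y).space K a))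
    have h2 := LinearMap.injective_iff_surjective.1 (hinj a)
    obtain ⟨x, hx⟩ := h2 (F.app a w)
    exact ⟨x, (F.app a).injective hx⟩
  refine ⟨c, fun i => ?_⟩
  let J : {y // c y = i} → PersistenceModule.{u, u} K := fun y => I y
  -- `Φ` is block diagonal along `c`, and `ψ` is its block at `i`; bijectivity of `Φ` passes to each
  -- block.
  let ψ : ∀ a, (directSum J).obj a →ₗ[K] (W i).obj a := fun a =>
    ∑ y : {y // c y = i}, g i y a ∘ₗ proj J y a
  have hψ : ∀ a x, ψ a x = ∑ y : {y // c y = i}, g i y a (proj J y a x) := fun a x => by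
    simp only [ψ, LinearMap.sum_apply]
    rfl
  have hψΦ : ∀ a (x : (directSum I).obj a) (z : (directSum J).obj a),
      (∀ y, proj J y a z = proj I y a x) → ψ a z = proj W i a (Φ a x) := by
    intro a x z hz
    rw [hψ, hΦ, ← Finset.sum_subtype_eq_sum_filter, Finset.subtype_univ]
    exact Finset.sum_congr rfl fun y _ => congrArg (g i y a) (hz y)
  have hψbij : ∀ a, Function.Bijective (ψ a) := by
    intro a
    constructor
    · rw [← LinearMap.ker_eq_bot, LinearMap.ker_eq_bot']
      intro x hx
      let x' : (directSum I).obj a := (fun y => if h : c y = i then proj J ⟨y, h⟩ a x else 0 :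
        ∀ y, (I y).obj a)
      have hx' : ∀ y, proj I y a x' = if h : c y = i then proj J ⟨y, h⟩ a x else 0 := fun y => rfl
      have hres : ∀ y : {y // c y = i}, proj J y a x = proj I y a x' := fun y =>
        ((hx' y).trans (dif_pos y.2)).symm
      have h0 : Φ a x' = 0 := by
        refine directSum_ext fun i' => ?_
        rw [map_zero]
        rcases eq_or_ne i' i with rfl | hi
        · rw [← hψΦ a x' x hres, hx]
        · rw [hΦ]
          refine Finset.sum_eq_zero fun y hy => ?_
          have : ¬ c y = i := fun h => hi ((Finset.mem_filter.1 hy).2 ▸ h)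
          rw [hx', dif_neg this, map_zero]
      have h1 : x' = 0 := (hbij a).1 (h0.trans (map_zero _).symm)
      refine directSum_ext fun y => ?_
      have h2 : proj I y a x' = 0 := by rw [h1, map_zero]
      exact (hres y).trans (h2.trans (map_zero _).symm)
    · intro w
      obtain ⟨x, hx⟩ := (hbij a).2 (incl W i a w)
      exact ⟨(fun y => proj I y a x : ∀ y : {y // c y = i}, (I y).obj a),
        (hψΦ a x _ fun y => rfl).trans (by rw [hx, proj_incl_same])⟩
  refine ⟨Iso.symm ⟨fun a => LinearEquiv.ofBijective (ψ a) (hψbij a), fun {a b} h x => ?_⟩⟩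
  change ψ b _ = (W i).map h (ψ a x)
  rw [hψ, hψ, map_sum]
  refine Finset.sum_congr rfl fun y _ => ?_
  rw [proj_map]
  exact hg i y h _

end PersistenceModule

/-! ### Metric estimates for bars -/

namespace Bar

theorem deathDist_comm (c d : WithTop ℝ) : deathDist c d = deathDist d c := by
  cases c <;> cases d <;> simp [deathDist, abs_sub_comm]

theorem deathDist_triangle (c d e : WithTop ℝ) :
    deathDist c e ≤ deathDist c d + deathDist d e := by
  cases c <;> cases d <;> cases e <;> simp [deathDist]
  rw [← ENNReal.ofReal_add (abs_nonneg _) (abs_nonneg _)]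
  exact ENNReal.ofReal_le_ofReal (abs_sub_le _ _ _)

theorem eq_of_deathDist_eq_zero {c d : WithTop ℝ} (h : deathDist c d = 0) : c = d := by
  cases c <;> cases d <;> simp_all [deathDist, sub_eq_zero]

theorem ofReal_abs_eq_deathDist (a b : ℝ) : ENNReal.ofReal |a - b| = deathDist a b := rfl

theorem matchCost_triangle (p q r : Bar) : p.matchCost r ≤ p.matchCost q + q.matchCost r := by
  simp only [matchCost, ofReal_abs_eq_deathDist]
  exact max_le ((deathDist_triangle _ q.birth _).trans (add_le_add (le_max_left _ _)
    (le_max_left _ _))) ((deathDist_triangle _ q.death _).trans (add_le_add (le_max_right _ _)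
    (le_max_right _ _)))

theorem eq_of_matchCost_eq_zero {p q : Bar} (h : p.matchCost q = 0) : p = q := by
  obtain ⟨h1, h2⟩ := max_eq_bot.1 h
  have h1 := WithTop.coe_injective (eq_of_deathDist_eq_zero h1)
  have h2 := eq_of_deathDist_eq_zero h2
  cases p
  cases q
  simp_all

theorem unmatchedCost_pos (p : Bar) : 0 < p.unmatchedCost := by
  refine ENNReal.div_pos (fun h => p.lt.ne (eq_of_deathDist_eq_zero h)) (by simp)

/-- Each endpoint moves by at most the matching cost, so half the persistence changes by at most
that cost. -/
theorem unmatchedCost_le (p q : Bar) : p.unmatchedCost ≤ p.matchCost q + q.unmatchedCost := by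
  have h1 : deathDist p.birth p.death ≤
      p.matchCost q + deathDist q.birth q.death + p.matchCost q :=
    (deathDist_triangle _ q.death _).trans (add_le_add ((deathDist_triangle _ q.birth _).trans
      (add_le_add_left (le_max_left _ _) _))
      ((deathDist_comm _ _).trans_le (le_max_right _ _)))
  rw [unmatchedCost, unmatchedCost]
  refine (ENNReal.div_le_div_right h1 2).trans (le_of_eq ?_)
  rw [add_right_comm, ENNReal.add_div, ENNReal.add_div, ENNReal.add_halves]

/-- The interval is longer than `2ε`, so its generator survives a round trip through an
`ε`-interleaving. -/
theorem alive_of_lt_unmatchedCost {p : Bar} {ε : ℝ} (hε : 0 ≤ ε)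
    (h : ENNReal.ofReal ε < p.unmatchedCost) : p.Alive (p.birth + ε + ε) := by
  refine ⟨by linarith, ?_⟩
  rw [unmatchedCost, ENNReal.lt_div_iff_mul_lt (by simp) (by simp)] at h
  have hlt := p.lt
  cases hd : p.death with
  | top => exact WithTop.coe_lt_top _
  | coe d =>
    rw [hd] at h hlt
    have hlt := WithTop.coe_lt_coe.1 hlt
    rw [← ofReal_abs_eq_deathDist, mul_two, ← ENNReal.ofReal_add hε hε,
      ENNReal.ofReal_lt_ofReal_iff (by rw [abs_pos]; linarith), abs_of_neg (by linarith)] at h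
    exact WithTop.coe_lt_coe.2 (by linarith)

end Bar

/-! ### Persistent bars under interleavings -/

namespace PersistenceModule

variable {K : Type u} [Field K]

/-- A point of the diagram of `X` which is far enough from the diagonal has a close point in the
diagram of every module interleaved with `X`. -/
theorem exists_matchCost_le_of_interleaving {X : PersistenceModule.{u, v} K}
    {Y : PersistenceModule.{u, w} K} {D E : Diagram} (hX : X.HasDiagram D) (hY : Y.HasDiagram E)
    {ε ε' : ℝ} (hε : 0 ≤ ε) (hε' : ε' = ε) (α : EpsMorphism ε X Y) (β : EpsMorphism ε' Y X)
    (hαβ : ∀ a (x : X.obj a), β.app (a + ε) (α.app a x) = X.map (by linarith) x)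
    {p : Bar} (hp : p ∈ D) (hpε : ENNReal.ofReal ε < p.unmatchedCost) :
    ∃ q ∈ E, p.matchCost q ≤ ENNReal.ofReal ε := by
  -- The two shifts are separate variables because they arise as `|t - s|` and `|s - t|`, equal only
  -- propositionally.
  subst ε'
  obtain ⟨n, p, rfl, ⟨A⟩⟩ := hX
  obtain ⟨m, q, rfl, ⟨B⟩⟩ := hY
  obtain ⟨y, -, rfl⟩ := Multiset.mem_map.1 hp
  set I : Fin n → PersistenceModule.{u, u} K := fun y => (p y).intervalModule K
  set J : Fin m → PersistenceModule.{u, u} K := fun y => (q y).intervalModule K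
  have hmono : Monotone fun a : ℝ => a + ε := fun a b h => by simpa using h
  let f : ∀ z a, (I y).obj a →ₗ[K] (J z).obj (a + ε) := fun z a =>
    proj J z _ ∘ₗ (B.app _).toLinearMap ∘ₗ α.app a ∘ₗ (A.app a).symm.toLinearMap ∘ₗ incl I y a
  let g : ∀ z a, (J z).obj a →ₗ[K] (I y).obj (a + ε) := fun z a =>
    proj I y _ ∘ₗ (A.app _).toLinearMap ∘ₗ β.app a ∘ₗ (B.app a).symm.toLinearMap ∘ₗ incl J z a
  have hf : ∀ z, IsNatural hmono (f z) := fun z a b h x => by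
    simp only [f, LinearMap.comp_apply, LinearEquiv.coe_coe]
    rw [incl_map, A.symm_naturality, α.naturality, B.naturality, proj_map]
  have hg : ∀ z, IsNatural hmono (g z) := fun z a b h x => by
    simp only [g, LinearMap.comp_apply, LinearEquiv.coe_coe]
    rw [incl_map, B.symm_naturality, β.naturality, A.naturality, proj_map]
  -- The round trip from `I y` to itself, split over the bars of `Y`, is the transition map by `2ε`.
  have hsum : ∀ a (x : (I y).obj a),
      ∑ z, g z (a + ε) (f z a x) = (I y).map (by linarith) x := by
    intro a x
    have h1 := sum_incl_proj J _ (B.app _ (α.app a ((A.app a).symm (incl I y a x))))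
    have h2 := congrArg (fun w => proj I y _ (A.app _ (β.app _ ((B.app _).symm w)))) h1
    simp only [map_sum, LinearEquiv.symm_apply_apply] at h2
    rw [hαβ, A.naturality, LinearEquiv.apply_symm_apply, proj_map, proj_incl_same] at h2
    exact h2
  have hne : ∑ z, g z _ (f z _ ((p y).gen K)) ≠ 0 := by
    rw [hsum]
    exact Bar.map_ne_zero _ (Bar.alive_of_lt_unmatchedCost hε hpε) Bar.gen_ne_zero
  -- Some bar `q z` carries a non-zero part of the round trip. Both halves are then non-zero, and
  -- each bounds the endpoints on one side up to `ε`.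
  obtain ⟨z, -, hz⟩ := Finset.exists_ne_zero_of_sum_ne_zero hne
  refine ⟨q z, Multiset.mem_map_of_mem _ (Finset.mem_univ z), ?_⟩
  have h1 := Bar.le_of_natural_ne_zero (hf z) (a := (p y).birth) (x := (p y).gen K)
    (fun h => hz (by rw [h, map_zero]))
  have h2 := Bar.le_of_natural_ne_zero (hg z) hz
  refine max_le (ENNReal.ofReal_le_ofReal (abs_le.2 ⟨by linarith [h1.1], by linarith [h2.1]⟩)) ?_
  cases hd : (p y).death with
  | top =>
    cases hd' : (q z).death with
    | top => simp [Bar.deathDist]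
    | coe d' =>
      have := h2.2 d' hd'
      rw [hd] at this
      simp at this
  | coe d =>
    have h3 := h1.2 d hd
    cases hd' : (q z).death with
    | top =>
      rw [hd'] at h3
      simp at h3
    | coe d' =>
      have h4 := h2.2 d' hd'
      rw [hd'] at h3
      rw [hd] at h4
      have h3 := WithTop.coe_le_coe.1 h3
      have h4 := WithTop.coe_le_coe.1 h4
      exact ENNReal.ofReal_le_ofReal (abs_le.2 ⟨by linarith, by linarith⟩)

end PersistenceModule

/-! ### Diagrams of direct summands -/

namespace PersistenceModule

variable {K : Type u} [Field K]

theorem _root_.Multiset.map_univ_val_eq_sum {ι α : Type*} [Fintype ι] (p : ι → α) :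
    Multiset.map p Finset.univ.val = ∑ y, {p y} := by
  rw [Finset.sum, ← Multiset.sum_map_singleton (Multiset.map p _), Multiset.map_map]
  rfl

/-- Allows any finite index type in place of `Fin n`, in particular the fibres of the owner map. -/
theorem hasDiagram_of_iso {X : PersistenceModule.{u, v} K} {ι : Type} [Fintype ι] (p : ι → Bar)
    (e : X.Iso (directSum fun y => (p y).intervalModule K)) : X.HasDiagram (∑ y, {p y}) := by
  let σ := Fintype.equivFin ι
  refine ⟨Fintype.card ι, fun l => p (σ.symm l), ?_, ⟨e.trans ⟨fun a =>
    LinearEquiv.piCongrLeft' K (fun y => ((p y).intervalModule K).obj a) σ, fun h x => rfl⟩⟩⟩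
  rw [Multiset.map_univ_val_eq_sum]
  exact Equiv.sum_comp σ.symm fun y => ({p y} : Multiset Bar)

/-- The diagram of a finite direct sum with a simple diagram is the union of diagrams of the
summands. -/
theorem HasDiagram.exists_of_iso_directSum {X : PersistenceModule.{u, v} K} {D : Diagram}
    (hX : X.HasDiagram D) (hD : D.Nodup) {κ : Type} [Fintype κ] (W : κ → PersistenceModule.{u, w} K)
    (e : X.Iso (directSum W)) :
    ∃ E : κ → Diagram, (∀ i, (W i).HasDiagram (E i)) ∧ ∑ i, E i = D := by
  classical
  obtain ⟨n, p, rfl, ⟨A⟩⟩ := hX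
  have hp : Function.Injective p := fun x y h =>
    Multiset.inj_on_of_nodup_map hD x (Finset.mem_univ x) y (Finset.mem_univ y) h
  obtain ⟨c, hc⟩ := exists_iso_fiber_of_directSum_iso hp W (e.symm.trans A)
  refine ⟨fun i => ∑ y : {y // c y = i}, {p y},
    fun i => hasDiagram_of_iso (fun y : {y // c y = i} => p y) (hc i).some, ?_⟩
  rw [Multiset.map_univ_val_eq_sum, ← Finset.sum_fiberwise (s := Finset.univ) (g := c)]
  refine Finset.sum_congr rfl fun i _ => ?_
  rw [← Finset.sum_subtype_eq_sum_filter, Finset.subtype_univ]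

theorem HasDiagram.subsingleton_of_zero {X : PersistenceModule.{u, v} K}
    (hX : X.HasDiagram 0) (a : ℝ) : Subsingleton (X.obj a) := by
  obtain ⟨n, p, h, ⟨A⟩⟩ := hX
  have hn : IsEmpty (Fin n) := by
    refine ⟨fun y => ?_⟩
    have := Multiset.mem_map_of_mem p (Finset.mem_univ_val y)
    rw [h] at this
    simp at this
  exact (A.app a).toEquiv.injective.subsingleton (β := ∀ y, (p y).space K a)

end PersistenceModule

/-! ### Points of nearby and of simple diagrams -/

namespace Diagram

/-- If two diagrams are close, then every point of the first one is close to a point of the second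
one or to the diagonal. -/
theorem exists_matchCost_lt_or_unmatchedCost_lt {X Y : Diagram} {ε : ℝ≥0∞}
    (h : bottleneck X Y < ε) {p : Bar} (hp : p ∈ X) :
    (∃ q ∈ Y, p.matchCost q < ε) ∨ p.unmatchedCost < ε := by
  obtain ⟨M, hM⟩ := iInf_lt_iff.1 h
  rw [← M.fst_eq, Multiset.mem_add] at hp
  rcases hp with hp | hp
  · obtain ⟨m, hm, rfl⟩ := Multiset.mem_map.1 hp
    refine Or.inl ⟨m.2, ?_, lt_of_le_of_lt ?_ hM⟩
    · rw [← M.snd_eq]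
      exact Multiset.mem_add.2 (Or.inl (Multiset.mem_map_of_mem _ hm))
    · exact le_max_of_le_left (le_iSup₂_of_le m hm le_rfl)
  · exact Or.inr (lt_of_le_of_lt (le_max_of_le_right (le_max_of_le_left
      (le_iSup₂_of_le p hp le_rfl))) hM)

/-- A point shared by two different terms would have multiplicity at least two in the sum. Thus a
bar determines both its vine and its owner. -/
theorem _root_.Multiset.eq_of_mem_of_nodup_sum {ι α : Type*} [Fintype ι] {D : ι → Multiset α}
    (h : (∑ i, D i).Nodup) {i j : ι} {p : α} (hi : p ∈ D i) (hj : p ∈ D j) : i = j := by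
  classical
  by_contra hij
  have hle : D i + D j ≤ ∑ i, D i := by
    rw [← Finset.sum_pair hij]
    exact Finset.sum_le_sum_of_subset (Finset.subset_univ _)
  exact Multiset.disjoint_left.1 (Multiset.nodup_add.1 (Multiset.nodup_of_le hle h)).2.2 hi hj

end Diagram

/-! ### Vines stay in one summand -/

namespace VineyardModule

variable {K : Type u} [Field K] {T₀ T₁ : ℝ}

/-- A point of a vine that belongs to a summand at time `t` belongs to it at all nearby times, if
the diagram at time `t` is simple. -/
theorem exists_forall_mem_of_mem {N : ℕ} (γ : Fin N → Vine T₀ T₁)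
    (W : VineyardModule.{u, v} K T₀ T₁) (D : Set.Icc T₀ T₁ → Diagram)
    (hD : ∀ t, (W.fiber t).HasDiagram (D t)) (hle : ∀ t, D t ≤ ∑ j, (γ j).diagram t)
    {t : Set.Icc T₀ T₁} (ht : (∑ j, (γ j).diagram t).Nodup) {j : Fin N} {p : Bar}
    (hj : p ∈ (γ j).diagram t) (hp : p ∈ D t) :
    ∃ δ : ℝ, 0 < δ ∧ ∀ s : Set.Icc T₀ T₁, |(s : ℝ) - t| < δ → ∃ q ∈ (γ j).diagram s, q ∈ D s := by
  classical
  -- a radius separating `p` from the diagonal and the other points at time `t`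
  obtain ⟨ε, hε0, hεp, hε⟩ : ∃ ε : ℝ≥0∞, 0 < ε ∧ ε + ε ≤ p.unmatchedCost ∧
      ∀ l, l ≠ j → ∀ q ∈ (γ l).diagram t, ε + ε ≤ p.matchCost q := by
    -- Finitely many positive costs have a positive minimum; it is halved because two errors below
    -- `ε` get added later.
    let S : Finset ℝ≥0∞ := insert p.unmatchedCost
      (((∑ j, (γ j).diagram t).toFinset.erase p).image fun q => p.matchCost q)
    have hS : S.Nonempty := Finset.insert_nonempty _ _
    have hmin : ∀ x ∈ S, S.min' hS / 2 + S.min' hS / 2 ≤ x := fun x hx => by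
      rw [ENNReal.add_halves]
      exact S.min'_le x hx
    refine ⟨S.min' hS / 2, ENNReal.div_pos ?_ (by simp), hmin _ (Finset.mem_insert_self _ _),
      fun l hl q hq => hmin _ (Finset.mem_insert_of_mem (Finset.mem_image_of_mem _ ?_))⟩
    · have h := S.min'_mem hS
      rcases Finset.mem_insert.1 h with h | h
      · rw [h]
        exact p.unmatchedCost_pos.ne'
      · obtain ⟨q, hq, hq'⟩ := Finset.mem_image.1 h
        rw [← hq']
        exact fun h0 => (Finset.mem_erase.1 hq).1 (Bar.eq_of_matchCost_eq_zero h0).symm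
    · refine Finset.mem_erase.2 ⟨?_, Multiset.mem_toFinset.2
        (Multiset.mem_sum.2 ⟨l, Finset.mem_univ l, hq⟩)⟩
      rintro rfl
      exact hl (Multiset.eq_of_mem_of_nodup_sum ht hq hj)
  choose δ hδ0 hδ using fun l => (γ l).continuous t ε hε0
  obtain ⟨η, hη0, hη⟩ : ∃ η : ℝ, 0 < η ∧ ENNReal.ofReal η ≤ ε := by
    obtain ⟨η, hη0, hη⟩ := ENNReal.lt_iff_exists_nnreal_btwn.1 hε0
    exact ⟨η, by exact_mod_cast hη0, by simpa using hη.le⟩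
  obtain ⟨m, hm⟩ : ∃ m : ℝ, 0 < m ∧ ∀ l, m ≤ δ l := by
    have : Nonempty (Fin N) := ⟨j⟩
    obtain ⟨l, hl⟩ := Finite.exists_min δ
    exact ⟨δ l, hδ0 l, hl⟩
  refine ⟨min η m, lt_min hη0 hm.1, fun s hs => ?_⟩
  have hsε : ENNReal.ofReal |(s : ℝ) - t| < ε :=
    ((ENNReal.ofReal_lt_ofReal_iff hη0).2 (hs.trans_le (min_le_left _ _))).trans_le hη
  have hpu : ENNReal.ofReal |(t : ℝ) - s| < p.unmatchedCost := by
    rw [abs_sub_comm]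
    exact hsε.trans_le (le_self_add.trans hεp)
  -- The interleaving is that of the summand `W`, so the bar close to `p` is again a bar of `W`.
  obtain ⟨q, hq, hpq⟩ := PersistenceModule.exists_matchCost_le_of_interleaving (hD t) (hD s)
    (abs_nonneg _) (abs_sub_comm _ _) (W.inter t s) (W.inter s t) (W.inter_inter t s) hp hpu
  rw [abs_sub_comm] at hpq
  have hpq := hpq.trans_lt hsε
  obtain ⟨l, -, hl⟩ := Multiset.mem_sum.1 (Multiset.mem_of_le (hle s) hq)
  rcases eq_or_ne l j with rfl | hlj
  · exact ⟨q, hl, hq⟩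
  -- If `q` lay on another vine `l`, continuity would put a point of `γ l` at time `t`, or the
  -- diagonal, within `ε` of `q`, hence within `2ε` of `p`.
  · exfalso
    rcases Diagram.exists_matchCost_lt_or_unmatchedCost_lt
      (hδ l s (hs.trans_le ((min_le_right _ _).trans (hm.2 l)))) hl with ⟨r, hr, hqr⟩ | hqr
    · exact absurd ((hε l hlj r hr).trans (Bar.matchCost_triangle p q r))
        (not_le.2 (ENNReal.add_lt_add hpq hqr))
    · exact absurd (hεp.trans (Bar.unmatchedCost_le p q)) (not_le.2 (ENNReal.add_lt_add hpq hqr))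

end VineyardModule

theorem mainTheorem10 {K : Type u} [Field K] {T₀ T₁ : ℝ}
    (V : VineyardModule.{u, v} K T₀ T₁) {N : ℕ} (γ : Fin N → Vine T₀ T₁)
    (hγ : V.HasVines γ Finset.univ)
    (hmult : ∀ t : Set.Icc T₀ T₁, (∑ j, (γ j).diagram t).Nodup)
    {k : ℕ} (W : Fin k → VineyardModule.{u, v} K T₀ T₁)
    (e : V.Iso (VineyardModule.directSum W))
    (hW : ∀ i, (W i).Indecomposable) :
    k ≤ N ∧ ∃ P : Fin k → Finset (Fin N),
      (∀ i, (P i).Nonempty) ∧ (∀ j, ∃! i, j ∈ P i) ∧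
      ∀ i, (W i).HasVines γ (P i) := by
  classical
  have hdec : ∀ t, ∃ E : Fin k → Diagram, (∀ i, ((W i).fiber t).HasDiagram (E i)) ∧
      ∑ i, E i = ∑ j, (γ j).diagram t := fun t =>
    (hγ t).exists_of_iso_directSum (hmult t) (fun i => (W i).fiber t) (e.app t)
  choose D hD hsum using hdec
  have hDnodup : ∀ t, (∑ i, D t i).Nodup := fun t => (hsum t).symm ▸ hmult t
  have hle : ∀ i t, D t i ≤ ∑ j, (γ j).diagram t := fun i t => by
    rw [← hsum]
    exact Finset.single_le_sum (fun _ _ => zero_le) (Finset.mem_univ i)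
  -- the vine `γ j` stays in one summand
  have hconst : ∀ j, ∃ i, ∀ t, ∀ p ∈ (γ j).diagram t, p ∈ D t i := by
    intro j
    have hex : ∀ t : (γ j).support, ∃ i, ∀ p ∈ (γ j).diagram ⟨t, t.2.1⟩, p ∈ D ⟨t, t.2.1⟩ i := by
      rintro ⟨t, ht, hne⟩
      obtain ⟨p, hp⟩ := Multiset.exists_mem_of_ne_zero hne
      have hp' : p ∈ ∑ i, D ⟨t, ht⟩ i := by
        rw [hsum]
        exact Multiset.mem_sum.2 ⟨j, Finset.mem_univ j, hp⟩
      obtain ⟨i, -, hi⟩ := Multiset.mem_sum.1 hp'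
      refine ⟨i, fun q hq => ?_⟩
      obtain ⟨r, hr⟩ := Multiset.card_eq_one.1
        (le_antisymm ((γ j).card_le_one ⟨t, ht⟩) (Multiset.card_pos.2 hne))
      rw [hr, Multiset.mem_singleton] at hp hq
      rwa [hq, ← hp]
    choose f hf using hex
    -- At a time `s` near `t`, the bar of `γ j` is owned both by `f t` and by `f s`; owners are
    -- unique.
    have hloc : Continuous f := by
      refine IsLocallyConstant.continuous ((IsLocallyConstant.iff_eventually_eq f).2 fun t => ?_)
      obtain ⟨p, hp⟩ := Multiset.exists_mem_of_ne_zero t.2.2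
      obtain ⟨δ, hδ, h⟩ := VineyardModule.exists_forall_mem_of_mem γ (W (f t)) (fun s => D s (f t))
        (fun s => hD s (f t)) (hle (f t)) (hmult _) hp (hf t p hp)
      filter_upwards [Metric.ball_mem_nhds t hδ] with s hs
      obtain ⟨q, hq, hq'⟩ := h ⟨s, s.2.1⟩ hs
      exact Multiset.eq_of_mem_of_nodup_sum (hDnodup _) (hf s q hq) hq'
    have := isPreconnected_iff_preconnectedSpace.1 (γ j).support_interval.isPreconnected
    obtain ⟨t₀, ht₀⟩ := (γ j).support_nonempty
    refine ⟨f ⟨t₀, ht₀⟩, fun t p hp => ?_⟩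
    have ht : (t : ℝ) ∈ (γ j).support := ⟨t.2, fun h => by
      rw [h] at hp
      simp at hp⟩
    rw [PreconnectedSpace.constant this hloc (x := ⟨t₀, ht₀⟩) (y := ⟨t, ht⟩)]
    exact hf ⟨t, ht⟩ p hp
  choose c hc using hconst
  -- Both sides lie in a diagram without multiplicities, so comparing members suffices.
  have hvines : ∀ i t, D t i = ∑ j with c j = i, (γ j).diagram t := by
    intro i t
    refine (Multiset.Nodup.ext (Multiset.nodup_of_le (hle i t) (hmult t))
      (Multiset.nodup_of_le (Finset.sum_le_sum_of_subset (Finset.subset_univ _)) (hmult t))).2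
      fun p => ⟨fun hp => ?_, fun hp => ?_⟩
    · obtain ⟨j, -, hj⟩ := Multiset.mem_sum.1 (Multiset.mem_of_le (hle i t) hp)
      refine Multiset.mem_sum.2 ⟨j, ?_, hj⟩
      simpa using Multiset.eq_of_mem_of_nodup_sum (hDnodup t) (hc j t p hj) hp
    · obtain ⟨j, hji, hj⟩ := Multiset.mem_sum.1 hp
      rw [← (Finset.mem_filter.1 hji).2]
      exact hc j t p hj
  -- A summand owning no vine has empty diagram at every time, hence is zero.
  have hsurj : Function.Surjective c := by
    intro i
    by_contra! h
    refine (hW i).1 fun t => PersistenceModule.HasDiagram.subsingleton_of_zero ?_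
    have h0 : D t i = 0 := by
      rw [hvines, Finset.filter_false_of_mem fun j _ => h j, Finset.sum_empty]
    exact h0 ▸ hD t i
  refine ⟨by simpa using Fintype.card_le_of_surjective c hsurj,
    fun i => Finset.univ.filter fun j => c j = i, fun i => ?_, fun j => ?_, fun i t => ?_⟩
  · obtain ⟨j, hj⟩ := hsurj i
    exact ⟨j, by simpa using hj⟩
  · exact ⟨c j, by simp, fun i hi => (Finset.mem_filter.1 hi).2.symm⟩
  · rw [← hvines]
    exact hD t i
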